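/- A commutative integral residuated lattice (CIRL) is an algebra $(A,\wedge,\vee,\cdot,\to,1)$ such that $(A,\wedge,\vee)$ is a lattice with top element $1$, $(A,\cdot,1)$ is a commutative monoid, and $xy\le z \iff x\le y\to z$. It is semilinear if it satisfies $(x\to y)\vee(y\to x)=1$ (equivalently, it is a subdirect product of chains). An $\mathsf{FL_{ew}}$-algebra is a CIRL with an additional constant $0$ that is its least element; $\neg x := x\to 0$. $\mathsf{MTL}$ is the variety of semilinear $\mathsf{FL_{ew}}$-algebras, $\mathsf{IMTL}$ its subvariety given by $\neg\neg x=x$, and $\mathsf{SMTL}$ its subvariety given by $x\wedge\neg x=0$. A member of a variety is $m$-potent if it satisfies $x^m=x^{m+1}$. A nucleus on a CIRL $A$ is a closure operator $\delta$ on $A$ with $\delta(x)\delta(y)\le\delta(xy)$. For $n\ge 2$ the generalized $n$-rotation $A^\delta_n$ is the $\mathsf{FL_{ew}}$-algebra on the disjoint union of $A$, $\{\ell_1,\dots,\ell_{n-2}\}$ and $\delta[A]'=\{b':b\in\delta[A]\}$, with $1=1_A$ and $0=1'$, ordered by the order of $A$ on $A$, by $b'\le c' \iff c\le b$ on $\delta[A]'$,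 and by $b'<\ell_1<\dots<\ell_{n-2}<a$ for $a\in A$, $b\in\delta[A]$. Its product is commutative, extends that of $A$, and satisfies $a\cdot b'=(a\to b)'$, $a\cdot\ell_i=\ell_i$, $b'\cdot c'=b'\cdot\ell_i=0$ and $\ell_i\cdot\ell_j=\ell_{\max(0,\,i+j-(n-1))}$ for $a\in A$, $b,c\in\delta[A]$, $0<i,j<n-1$, where $\ell_0:=0$; its implication is the residual of this product. A class $\mathsf K$ of algebras of the same signature has the amalgamation property (AP) if for all $A,B,C\in\mathsf K$ and all embeddings $i:A\to B$, $j:A\to C$ there are $D\in\mathsf K$ and embeddings $h:B\to D$, $k:C\to D$ with $h\circ i=k\circ j$. Theorem. The following varieties of $\mathsf{FL_{ew}}$-algebras do not have the AP: (1) $\mathsf{IMTL}$; (2) $\mathsf{SMTL}$; (3) for every $n\ge 2$, the variety generated by all generalized $n$-rotations $A^\delta_n$ of semilinear CIRLs $A$ with respect to arbitrary nuclei $\delta$; and also the variety generated by these algebras for all $n\ge 2$ together; (4) for every $m\ge 2$, the $m$-potent subvariety of each of the above varieties. -/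

import Mathlib

universe u

/-- A commutative integral residuated lattice: a lattice and a commutative monoid whose unit is
the top element, with the residual `imp x y` (written `x → y` in the literature). -/
class CIRL (A : Type u) extends Lattice A, CommMonoid A where
  imp : A → A → A
  le_imp_iff : ∀ x y z : A, x ≤ imp y z ↔ x * y ≤ z
  le_one' : ∀ x : A, x ≤ 1

/-- An `FL_ew`-algebra: a commutative integral residuated lattice with a constant `0`,
written `⊥` here, that is the least element. -/
class FLew (A : Type u) extends CIRL A, OrderBot A

namespace CIRL

variable {A : Type u} [CIRL A]

theorem imp_mul_le (x y : A) : imp x y * x ≤ y := (le_imp_iff _ _ _).1 le_rfl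

theorem mul_le_mul_right'' {x y : A} (h : x ≤ y) (z : A) : x * z ≤ y * z :=
  (le_imp_iff _ _ _).1 (h.trans ((le_imp_iff _ _ _).2 le_rfl))

theorem mul_le_mul_left'' {x y : A} (h : x ≤ y) (z : A) : z * x ≤ z * y := by
  rw [mul_comm z x, mul_comm z y]; exact mul_le_mul_right'' h z

theorem mul_le_right (x y : A) : x * y ≤ y := by
  have := mul_le_mul_right'' (le_one' x) y
  rwa [one_mul] at this

theorem imp_one (x : A) : imp x 1 = 1 :=
  le_antisymm (le_one' _) ((le_imp_iff _ _ _).2 (le_one' _))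

theorem imp_self (x : A) : imp x x = 1 :=
  le_antisymm (le_one' _) ((le_imp_iff _ _ _).2 (by rw [one_mul]))

theorem one_imp (x : A) : imp 1 x = x :=
  le_antisymm (by simpa using imp_mul_le 1 x) ((le_imp_iff _ _ _).2 (by rw [mul_one]))

theorem imp_imp (x y z : A) : imp x (imp y z) = imp (x * y) z := by
  apply le_antisymm
  · rw [le_imp_iff, ← mul_assoc, ← le_imp_iff]; exact imp_mul_le _ _
  · rw [le_imp_iff, le_imp_iff, mul_assoc]; exact imp_mul_le _ _

theorem one_le_iff (x : A) : 1 ≤ x ↔ x = 1 := ⟨fun h => le_antisymm (le_one' _) h, fun h => h.ge⟩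

/-- The prelinearity identity, which axiomatizes the semilinear members (the subdirect products
of chains) among the commutative integral residuated lattices. -/
def Prelinear (A : Type u) [CIRL A] : Prop := ∀ x y : A, imp x y ⊔ imp y x = 1

end CIRL

/-- A nucleus on a commutative integral residuated lattice: a closure operator `δ` with
`δ x * δ y ≤ δ (x * y)`. -/
structure RLNucleus (A : Type u) [CIRL A] where
  toFun : A → A
  monotone' : Monotone toFun
  le_apply : ∀ x, x ≤ toFun x
  idem : ∀ x, toFun (toFun x) = toFun x
  mul_le : ∀ x y, toFun x * toFun y ≤ toFun (x * y)

namespace RLNucleus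

variable {A : Type u} [CIRL A] (δ : RLNucleus A)

instance : CoeFun (RLNucleus A) (fun _ => A → A) := ⟨RLNucleus.toFun⟩

theorem apply_one : δ 1 = 1 := le_antisymm (CIRL.le_one' _) (δ.le_apply 1)

theorem le_of_fixed {x b : A} (hb : δ b = b) : δ x ≤ b ↔ x ≤ b :=
  ⟨fun h => (δ.le_apply x).trans h, fun h => hb ▸ δ.monotone' h⟩

theorem fixed_imp (a : A) {b : A} (hb : δ b = b) : δ (CIRL.imp a b) = CIRL.imp a b := by
  refine le_antisymm ?_ (δ.le_apply _)
  rw [CIRL.le_imp_iff]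
  calc δ (CIRL.imp a b) * a ≤ δ (CIRL.imp a b) * δ a := CIRL.mul_le_mul_left'' (δ.le_apply a) _
    _ ≤ δ (CIRL.imp a b * a) := δ.mul_le _ _
    _ ≤ δ b := δ.monotone' (CIRL.imp_mul_le a b)
    _ = b := hb

theorem fixed_inf {b c : A} (hb : δ b = b) (hc : δ c = c) : δ (b ⊓ c) = b ⊓ c :=
  le_antisymm (le_inf ((δ.le_of_fixed hb).2 inf_le_left) ((δ.le_of_fixed hc).2 inf_le_right))
    (δ.le_apply _)

end RLNucleus

/-- The universe of the generalized `n`-rotation (`2 ≤ n`) of `A` with respect to the nucleus `δ`: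
`A` itself (`up a`), the elements `ℓ_1 < ⋯ < ℓ_{n-2}` (`mid i` is `ℓ_{i+1}`), and the
rotated copy `{b' : b ∈ δ[A]}` (`low b` is `b'`; the image `δ[A]` is the set of fixed points
of `δ`). -/
inductive GenRotation {A : Type u} [CIRL A] (δ : RLNucleus A) (n : ℕ) : Type u
  | up (a : A) : GenRotation δ n
  | mid (i : Fin (n - 2)) : GenRotation δ n
  | low (b : {b : A // δ b = b}) : GenRotation δ n

namespace GenRotation

variable {A : Type u} [CIRL A] {δ : RLNucleus A} {n : ℕ}

/-- The order: `b' < ℓ_i < a`, the order of `A` on `A`, and the dual order on `δ[A]'`. -/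
def le : GenRotation δ n → GenRotation δ n → Prop
  | up a, up b => a ≤ b
  | up _, mid _ => False
  | up _, low _ => False
  | mid _, up _ => True
  | mid i, mid j => i ≤ j
  | mid _, low _ => False
  | low _, up _ => True
  | low _, mid _ => True
  | low b, low c => c.1 ≤ b.1

/-- Meets; on the rotated copy `b' ∧ c' = δ(b ∨ c)'`. -/
def inf : GenRotation δ n → GenRotation δ n → GenRotation δ n
  | up a, up b => up (a ⊓ b)
  | up _, mid j => mid j
  | up _, low c => low c
  | mid i, up _ => mid i
  | mid i, mid j => mid (min i j)
  | mid _, low c => low c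
  | low b, up _ => low b
  | low b, mid _ => low b
  | low b, low c => low ⟨δ (b.1 ⊔ c.1), δ.idem _⟩

/-- Joins; on the rotated copy `b' ∨ c' = (b ∧ c)'`. -/
def sup : GenRotation δ n → GenRotation δ n → GenRotation δ n
  | up a, up b => up (a ⊔ b)
  | up a, mid _ => up a
  | up a, low _ => up a
  | mid _, up b => up b
  | mid i, mid j => mid (max i j)
  | mid i, low _ => mid i
  | low _, up b => up b
  | low _, mid j => mid j
  | low b, low c => low ⟨b.1 ⊓ c.1, δ.fixed_inf b.2 c.2⟩

/-- The least element `0 = 1'`. -/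
def zero : GenRotation δ n := low ⟨1, δ.apply_one⟩

/-- Products: those of `A` on `A`; `a · b' = (a → b)'`; `a · ℓ_i = ℓ_i`;
`ℓ_i · ℓ_j = ℓ_{max(0, i + j - (n - 1))}` as in the `n`-element MV-chain; and `0` otherwise. -/
def mul : GenRotation δ n → GenRotation δ n → GenRotation δ n
  | up a, up b => up (a * b)
  | up _, mid j => mid j
  | up a, low c => low ⟨CIRL.imp a c.1, δ.fixed_imp a c.2⟩
  | mid i, up _ => mid i
  | mid i, mid j =>
      if h : n - 2 ≤ i.1 + j.1 then mid ⟨i.1 + j.1 - (n - 2), by omega⟩ else zero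
  | mid _, low _ => zero
  | low b, up a => low ⟨CIRL.imp a b.1, δ.fixed_imp a b.2⟩
  | low _, mid _ => zero
  | low _, low _ => zero

/-- Residuals: those of `A` on `A`; `a → b' = δ(ab)'`; `b' → c' = c → b`; `a → ℓ_i = ℓ_i`;
`ℓ_i → ℓ_j = ℓ_{min(n - 1, n - 1 - i + j)}` and `ℓ_i → b' = ℓ_{n - 1 - i}` from the
`n`-element MV-chain; and `x → y = 1` whenever `x ≤ y`. -/
def imp : GenRotation δ n → GenRotation δ n → GenRotation δ n
  | up a, up b => up (CIRL.imp a b)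
  | up _, mid j => mid j
  | up a, low c => low ⟨δ (a * c.1), δ.idem _⟩
  | mid _, up _ => up 1
  | mid i, mid j =>
      if h : i ≤ j then up 1 else mid ⟨n - 2 - i.1 + j.1, by rw [Fin.le_def] at h; omega⟩
  | mid i, low _ => mid ⟨n - 2 - 1 - i.1, by omega⟩
  | low _, up _ => up 1
  | low _, mid _ => up 1
  | low b, low c => up (CIRL.imp c.1 b.1)

instance : FLew (GenRotation δ n) where
  le := le
  le_refl x := by cases x <;> simp [le]
  le_trans x y z := by
    cases x <;> cases y <;> cases z <;> simp only [le, true_imp_iff, imp_true_iff, false_imp_iff]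
    · exact le_trans
    · exact le_trans
    · exact fun h1 h2 => h2.trans h1
  le_antisymm x y := by
    cases x <;> cases y <;> simp only [le, false_imp_iff, imp_true_iff, true_imp_iff]
    · exact fun h1 h2 => by rw [le_antisymm h1 h2]
    · exact fun h1 h2 => by rw [le_antisymm h1 h2]
    · exact fun h1 h2 => by rw [Subtype.ext (le_antisymm h2 h1)]
  sup := sup
  le_sup_left x y := by cases x <;> cases y <;> simp [le, sup]
  le_sup_right x y := by cases x <;> cases y <;> simp [le, sup]
  sup_le x y z := by
    cases x <;> cases y <;> cases z <;> simp +contextual [le, sup]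
  inf := inf
  inf_le_left x y := by
    cases x <;> cases y <;> simp [le, inf]
    exact le_sup_left.trans (δ.le_apply _)
  inf_le_right x y := by
    cases x <;> cases y <;> simp [le, inf]
    exact le_sup_right.trans (δ.le_apply _)
  le_inf x y z := by
    cases x with
    | low b =>
      cases y <;> cases z <;> simp +contextual [le, inf, δ.le_of_fixed b.2]
    | _ => cases y <;> cases z <;> simp +contextual [le, inf]
  mul := mul
  mul_assoc x y z := by
    change mul (mul x y) z = mul x (mul y z)
    rcases x with a | i | b <;> rcases y with a' | j | b' <;> rcases z with a'' | k | b'' <;>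
      simp only [mul, zero, CIRL.imp_one, mul_assoc, CIRL.imp_imp]
    case up.mid.mid => split_ifs <;> simp [CIRL.imp_one]
    case up.low.up => simp only [mul_comm]
    case low.up.up => simp only [mul_comm]
    case mid.mid.up => split_ifs <;> simp [CIRL.imp_one]
    case mid.mid.low => split_ifs <;> rfl
    case low.mid.mid => split_ifs <;> rfl
    case mid.mid.mid =>
      by_cases h1 : n - 2 ≤ i.1 + j.1 <;> by_cases h2 : n - 2 ≤ j.1 + k.1 <;>
        simp only [h1, h2, dite_true, dite_false]
      · by_cases h3 : n - 2 ≤ i.1 + j.1 - (n - 2) + k.1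
        · rw [dif_pos h3, dif_pos (by omega)]
          congr 2
          omega
        · rw [dif_neg h3, dif_neg (by omega)]
      · rw [dif_neg (by omega)]
      · rw [dif_neg (by omega)]
  one := up 1
  one_mul x := by
    change mul (up 1) x = x
    cases x <;> simp [mul, CIRL.one_imp]
  mul_one x := by
    change mul x (up 1) = x
    cases x <;> simp [mul, CIRL.one_imp]
  mul_comm x y := by
    change mul x y = mul y x
    cases x <;> cases y <;> simp [mul, mul_comm, add_comm]
  imp := imp
  le_imp_iff x y z := by
    change le x (imp y z) ↔ le (mul x y) z
    rcases x with a | i | b <;> rcases y with a' | j | b' <;> rcases z with a'' | k | b'' <;>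
      simp only [mul, imp, zero, le, CIRL.le_one', CIRL.le_imp_iff]
    case up.mid.mid =>
      split_ifs with h
      · simpa [CIRL.le_one'] using h
      · simpa using h
    case up.low.low => rw [mul_comm]
    case mid.mid.up => split_ifs <;> simp
    case mid.mid.low =>
      rw [Fin.le_def]
      split_ifs with h
      · simp only [iff_false, not_le]; omega
      · simp only [CIRL.le_one', iff_true]; omega
    case mid.mid.mid =>
      split_ifs with h h' h' <;> rw [Fin.le_def] at h <;>
        simp only [Fin.le_def, true_iff, iff_true] <;> omega
    case low.up.low => rw [δ.le_of_fixed b.2, mul_comm]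
    case low.mid.mid => split_ifs <;> simp
  le_one' x := by
    change le x (up 1)
    cases x <;> simp [le, CIRL.le_one']
  bot := zero
  bot_le x := by
    cases x <;> simp [le, zero, CIRL.le_one']

end GenRotation

/-- A bundled `FL_ew`-algebra. -/
structure FLewAlg : Type (u + 1) where
  carrier : Type u
  [str : FLew carrier]

namespace FLewAlg

instance : CoeSort FLewAlg.{u} (Type u) := ⟨FLewAlg.carrier⟩

instance (A : FLewAlg.{u}) : FLew A := A.str

end FLewAlg

namespace FLew

/-- Homomorphisms of `FL_ew`-algebras: maps preserving `∧`, `∨`, `·`, `→`, `1` and `0`. -/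
structure IsHom {A B : Type u} [FLew A] [FLew B] (f : A → B) : Prop where
  map_inf : ∀ x y, f (x ⊓ y) = f x ⊓ f y
  map_sup : ∀ x y, f (x ⊔ y) = f x ⊔ f y
  map_mul : ∀ x y, f (x * y) = f x * f y
  map_imp : ∀ x y, f (CIRL.imp x y) = CIRL.imp (f x) (f y)
  map_one : f 1 = 1
  map_bot : f ⊥ = ⊥

/-- Embeddings: injective homomorphisms. -/
structure IsEmbedding {A B : Type u} [FLew A] [FLew B] (f : A → B) : Prop extends IsHom f where
  injective : Function.Injective f

/-- The direct product of a family of `FL_ew`-algebras, with componentwise operations. -/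
instance instPi {ι : Type u} (A : ι → Type u) [∀ i, FLew (A i)] : FLew (∀ i, A i) where
  toLattice := Pi.instLattice
  toCommMonoid := Pi.commMonoid
  imp x y := fun i => CIRL.imp (x i) (y i)
  le_imp_iff _ _ _ := forall_congr' fun _ => CIRL.le_imp_iff _ _ _
  le_one' _ := fun _ => CIRL.le_one' _
  bot := fun _ => ⊥
  bot_le _ := fun _ => bot_le

end FLew

open FLew in
/-- A class of `FL_ew`-algebras is a variety if it is closed under homomorphic images,
subalgebras (and isomorphic copies) and direct products. -/
structure IsVariety (V : Set FLewAlg.{u}) : Prop where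
  image : ∀ (A B : FLewAlg.{u}) (f : A → B), IsHom f → Function.Surjective f → A ∈ V → B ∈ V
  subalgebra : ∀ (A B : FLewAlg.{u}) (f : A → B), IsEmbedding f → B ∈ V → A ∈ V
  prod : ∀ (ι : Type u) (A : ι → FLewAlg.{u}), (∀ i, A i ∈ V) → FLewAlg.mk (∀ i, A i) ∈ V

/-- The variety generated by a class of `FL_ew`-algebras. -/
def generatedVariety (K : Set FLewAlg.{u}) : Set FLewAlg.{u} :=
  {D | ∀ V : Set FLewAlg.{u}, IsVariety V → K ⊆ V → D ∈ V}

open FLew in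
/-- The amalgamation property for a class of `FL_ew`-algebras. -/
def HasAP (K : Set FLewAlg.{u}) : Prop :=
  ∀ A ∈ K, ∀ B ∈ K, ∀ C ∈ K, ∀ (i : A → B) (j : A → C), IsEmbedding i → IsEmbedding j →
    ∃ D ∈ K, ∃ (h : B → D) (k : C → D), IsEmbedding h ∧ IsEmbedding k ∧ h ∘ i = k ∘ j

/-- MTL-algebras: prelinear `FL_ew`-algebras. -/
def MTL : Set FLewAlg.{u} := {A | CIRL.Prelinear A}

/-- Involutive MTL-algebras: MTL-algebras satisfying `¬¬x = x`, where `¬x = x → 0`. -/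
def IMTL : Set FLewAlg.{u} := {A | A ∈ MTL ∧ ∀ x : A, CIRL.imp (CIRL.imp x ⊥) ⊥ = x}

/-- Pseudocomplemented MTL-algebras: MTL-algebras satisfying `x ∧ ¬x = 0`. -/
def SMTL : Set FLewAlg.{u} := {A | A ∈ MTL ∧ ∀ x : A, x ⊓ CIRL.imp x ⊥ = ⊥}

/-- All generalized `n`-rotations of semilinear commutative integral residuated lattices, with
respect to arbitrary nuclei. -/
def genRotations (n : ℕ) : Set FLewAlg.{u} :=
  {R | ∃ (A : Type u) (_ : CIRL A) (δ : RLNucleus A),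
    CIRL.Prelinear A ∧ R = FLewAlg.mk (GenRotation δ n)}

/-- The `m`-potent members of a class: those satisfying `x ^ m = x ^ (m + 1)`. -/
def potent (m : ℕ) (V : Set FLewAlg.{u}) : Set FLewAlg.{u} :=
  {A | A ∈ V ∧ ∀ x : A, x ^ m = x ^ (m + 1)}

/-!
All the failures come from one V-formation of finite chains. Let `A = {a < 1}` with `a` idempotent,
let `B = {a < b < 1}` with `b * b = a`, and let `C = {z < c < d < a < 1}`, where `a * a = a` and all
other products of two elements below `1` are equal to `z`. Then `b → a = b` in `B`, while `a * d = z`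
and `d → c = a = c → z` in `C`. In a semilinear amalgam the join of `b * d → c` and `c → b * d`
is `1`, but both lie below `b`:

* if `P = (b * d → c)`, then `P * b ≤ (d → c) = a`, so `P ≤ (b → a) = b`;
* if `Q = (c → b * d)`, then `Q * b * c ≤ b * b * d = a * d = z`, so `Q * b ≤ (c → z) = a`, and again
  `Q ≤ b`.

Hence `1 = P ⊔ Q ≤ b`, which is absurd (`CIRL.eq_one_of_amalgam`).

The constant `0` and the extra identities are provided by rotations. A homomorphism that commutes
with the nuclei extends to the `2`-rotations (`GenRotation.isEmbedding_map`), and an amalgam of the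
rotations is in particular a semilinear residuated lattice amalgamating `A`, `B` and `C`
(`not_hasAP_of_rotation_mem`). With the identity as nucleus the rotations are involutive; with the
nucleus that is constantly `1` they just add a new least element to the chain and are
pseudocomplemented. The `2`-rotations embed into the `n`-rotations for every `n`
(`GenRotation.isEmbedding_ofTwo`), so they lie in the variety generated by the latter, and they are
`2`-potent because `A`, `B` and `C` are, which gives the `m`-potent subvarieties.
-/

open FLew

/-! ### Residuated lattices -/

namespace CIRL

variable {A : Type u} [CIRL A]

theorem imp_eq_one {x y : A} (h : x ≤ y) : imp x y = 1 :=
  le_antisymm (le_one' _) ((le_imp_iff _ _ _).2 (by rwa [one_mul]))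

theorem prelinear_of_total (h : ∀ x y : A, x ≤ y ∨ y ≤ x) : Prelinear A := by
  intro x y
  rcases h x y with h | h
  · rw [imp_eq_one h]; exact sup_eq_left.2 (le_one' _)
  · rw [imp_eq_one h]; exact sup_eq_right.2 (le_one' _)

/-- The relations that hold in `B` and in `C` force `b = 1` in every semilinear residuated lattice
that contains both. -/
theorem eq_one_of_amalgam (hA : Prelinear A) {a b c d z : A} (hbb : b * b = a)
    (hba : imp b a = b) (had : a * d = z) (hdc : imp d c = a) (hcz : imp c z = a) : b = 1 := by
  refine (one_le_iff b).1 ?_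
  rw [← hA (b * d) c]
  refine sup_le ?_ ?_
  · calc imp (b * d) c ≤ imp b a := by
          rw [le_imp_iff, ← hdc, le_imp_iff, mul_assoc]
          exact imp_mul_le _ _
      _ = b := hba
  · calc imp c (b * d) ≤ imp b a := by
          rw [le_imp_iff, ← hcz, le_imp_iff, ← had, ← hbb, mul_right_comm, mul_comm _ b,
            mul_assoc b]
          exact mul_le_mul_left'' (imp_mul_le _ _) _
      _ = b := hba

/-- Homomorphisms of commutative integral residuated lattices, with no constant `0` to preserve. -/
structure IsRLHom {A B : Type u} [CIRL A] [CIRL B] (f : A → B) : Prop where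
  map_inf : ∀ x y, f (x ⊓ y) = f x ⊓ f y
  map_sup : ∀ x y, f (x ⊔ y) = f x ⊔ f y
  map_mul : ∀ x y, f (x * y) = f x * f y
  map_imp : ∀ x y, f (imp x y) = imp (f x) (f y)
  map_one : f 1 = 1

end CIRL

/-- The identity nucleus. -/
def RLNucleus.identity (A : Type u) [CIRL A] : RLNucleus A where
  toFun := id
  monotone' := monotone_id
  le_apply _ := le_rfl
  idem _ := rfl
  mul_le _ _ := le_rfl

/-- The largest nucleus, which is constantly `1`. -/
def RLNucleus.constOne (A : Type u) [CIRL A] : RLNucleus A where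
  toFun _ := 1
  monotone' := monotone_const
  le_apply := CIRL.le_one'
  idem _ := rfl
  mul_le _ _ := (mul_one _).le

/-! ### The three chains -/

/-- The chain `{a < 1}`, with `a` idempotent. -/
inductive ChainA : Type u
  | a | one

namespace ChainA

/-- The position in the chain. -/
def rank : ChainA.{u} → ℕ
  | a => 0
  | one => 1

theorem rank_injective : Function.Injective rank.{u} := by
  rintro (_ | _) (_ | _) h <;> first | rfl | cases h

noncomputable instance : LinearOrder ChainA.{u} := LinearOrder.lift' rank rank_injective

theorem le_iff (x y : ChainA.{u}) : x ≤ y ↔ rank x ≤ rank y := Iff.rfl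

noncomputable instance : CIRL ChainA.{u} where
  toLattice := inferInstance
  mul
    | one, y => y
    | a, _ => a
  one := one
  mul_assoc := by rintro (_ | _) (_ | _) (_ | _) <;> rfl
  one_mul := by rintro (_ | _) <;> rfl
  mul_one := by rintro (_ | _) <;> rfl
  mul_comm := by rintro (_ | _) (_ | _) <;> rfl
  imp
    | one, y => y
    | a, _ => one
  le_imp_iff := by
    rintro (_ | _) (_ | _) (_ | _) <;> simp only [le_iff] <;> decide
  le_one' := by rintro (_ | _) <;> exact (le_iff _ _).2 (by decide)

end ChainA

/-- The chain `{a < b < 1}`, with `b * b = a`. -/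
inductive ChainB : Type u
  | a | b | one

namespace ChainB

/-- The position in the chain. -/
def rank : ChainB.{u} → ℕ
  | a => 0
  | b => 1
  | one => 2

theorem rank_injective : Function.Injective rank.{u} := by
  rintro (_ | _ | _) (_ | _ | _) h <;> first | rfl | cases h

noncomputable instance : LinearOrder ChainB.{u} := LinearOrder.lift' rank rank_injective

theorem le_iff (x y : ChainB.{u}) : x ≤ y ↔ rank x ≤ rank y := Iff.rfl

noncomputable instance : CIRL ChainB.{u} where
  toLattice := inferInstance
  mul
    | one, y => y
    | x, one => x
    | _, _ => a
  one := one
  mul_assoc := by rintro (_ | _ | _) (_ | _ | _) (_ | _ | _) <;> rfl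
  one_mul := by rintro (_ | _ | _) <;> rfl
  mul_one := by rintro (_ | _ | _) <;> rfl
  mul_comm := by rintro (_ | _ | _) (_ | _ | _) <;> rfl
  imp
    | one, y => y
    | b, a => b
    | _, _ => one
  le_imp_iff := by
    rintro (_ | _ | _) (_ | _ | _) (_ | _ | _) <;> simp only [le_iff] <;> decide
  le_one' := by rintro (_ | _ | _) <;> exact (le_iff _ _).2 (by decide)

end ChainB

/-- The chain `{z < c < d < a < 1}`, where `a` is idempotent and all other products of two elements
below `1` are equal to `z`. -/
inductive ChainC : Type u
  | z | c | d | a | one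

namespace ChainC

/-- The position in the chain. -/
def rank : ChainC.{u} → ℕ
  | z => 0
  | c => 1
  | d => 2
  | a => 3
  | one => 4

theorem rank_injective : Function.Injective rank.{u} := by
  rintro (_ | _ | _ | _ | _) (_ | _ | _ | _ | _) h <;> first | rfl | cases h

noncomputable instance : LinearOrder ChainC.{u} := LinearOrder.lift' rank rank_injective

theorem le_iff (x y : ChainC.{u}) : x ≤ y ↔ rank x ≤ rank y := Iff.rfl

noncomputable instance : CIRL ChainC.{u} where
  toLattice := inferInstance
  mul
    | one, y => y
    | x, one => x
    | a, a => a
    | _, _ => z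
  one := one
  mul_assoc := by
    rintro (_ | _ | _ | _ | _) (_ | _ | _ | _ | _) (_ | _ | _ | _ | _) <;> rfl
  one_mul := by rintro (_ | _ | _ | _ | _) <;> rfl
  mul_one := by rintro (_ | _ | _ | _ | _) <;> rfl
  mul_comm := by rintro (_ | _ | _ | _ | _) (_ | _ | _ | _ | _) <;> rfl
  imp
    | one, y => y
    | a, z => d
    | a, c => d
    | a, d => d
    | d, z => a
    | d, c => a
    | c, z => a
    | _, _ => one
  le_imp_iff := by
    rintro (_ | _ | _ | _ | _) (_ | _ | _ | _ | _) (_ | _ | _ | _ | _) <;>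
      simp only [le_iff] <;> decide
  le_one' := by rintro (_ | _ | _ | _ | _) <;> exact (le_iff _ _).2 (by decide)

end ChainC

/-- The inclusion of `A` into `B`. -/
def ChainA.toB : ChainA.{u} → ChainB.{u}
  | a => .a
  | one => .one

/-- The inclusion of `A` into `C`. -/
def ChainA.toC : ChainA.{u} → ChainC.{u}
  | a => .a
  | one => .one

theorem ChainA.isRLHom_toB : CIRL.IsRLHom ChainA.toB.{u} := by
  have hm : Monotone ChainA.toB.{u} := by
    rintro (_ | _) (_ | _) h <;> rw [ChainA.le_iff] at h <;> revert h <;>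
      simp only [ChainB.le_iff] <;> decide
  refine ⟨fun x y => hm.map_inf x y, fun x y => hm.map_sup x y, ?_, ?_, rfl⟩ <;>
    rintro (_ | _) (_ | _) <;> rfl

theorem ChainA.isRLHom_toC : CIRL.IsRLHom ChainA.toC.{u} := by
  have hm : Monotone ChainA.toC.{u} := by
    rintro (_ | _) (_ | _) h <;> rw [ChainA.le_iff] at h <;> revert h <;>
      simp only [ChainC.le_iff] <;> decide
  refine ⟨fun x y => hm.map_inf x y, fun x y => hm.map_sup x y, ?_, ?_, rfl⟩ <;>
    rintro (_ | _) (_ | _) <;> rfl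

theorem ChainA.toB_injective : Function.Injective ChainA.toB.{u} := by
  rintro (_ | _) (_ | _) h <;> first | rfl | cases h

theorem ChainA.toC_injective : Function.Injective ChainA.toC.{u} := by
  rintro (_ | _) (_ | _) h <;> first | rfl | cases h

/-! ### Rotations -/

namespace GenRotation

variable {A B : Type u} [CIRL A] [CIRL B] {δ : RLNucleus A} {ε : RLNucleus B} {n : ℕ}

theorem prelinear (hA : CIRL.Prelinear A) : CIRL.Prelinear (GenRotation δ n) := by
  have key : ∀ x y : GenRotation δ n, le x y → CIRL.imp x y ⊔ CIRL.imp y x = 1 := fun x y h => by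
    rw [CIRL.imp_eq_one (show x ≤ y from h)]; exact sup_eq_left.2 (CIRL.le_one' _)
  have key' : ∀ x y : GenRotation δ n, le y x → CIRL.imp x y ⊔ CIRL.imp y x = 1 := fun x y h => by
    rw [sup_comm]; exact key y x h
  rintro (x | i | x) (y | j | y)
  · exact congrArg up (hA x y)
  · exact key' _ _ trivial
  · exact key' _ _ trivial
  · exact key _ _ trivial
  · exact (le_total i j).elim (key (mid i) (mid j)) (key' (mid i) (mid j))
  · exact key' _ _ trivial
  · exact key _ _ trivial
  · exact key _ _ trivial
  · exact congrArg up (hA y.1 x.1)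

/-- The map of rotations induced by a map that commutes with the nuclei. -/
def map (f : A → B) (h : ∀ x, f (δ x) = ε (f x)) (n : ℕ) : GenRotation δ n → GenRotation ε n
  | up a => up (f a)
  | mid i => mid i
  | low b => low ⟨f b.1, by rw [← h, b.2]⟩

theorem isEmbedding_map {f : A → B} (h : ∀ x, f (δ x) = ε (f x)) (hf : CIRL.IsRLHom f)
    (hinj : Function.Injective f) : IsEmbedding (map f h n) where
  map_inf := by
    rintro (x | i | x) (y | j | y) <;> try rfl
    · exact congrArg up (hf.map_inf x y)
    · exact congrArg low (Subtype.ext ((h _).trans (congrArg ε (hf.map_sup x.1 y.1))))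
  map_sup := by
    rintro (x | i | x) (y | j | y) <;> try rfl
    · exact congrArg up (hf.map_sup x y)
    · exact congrArg low (Subtype.ext (hf.map_inf x.1 y.1))
  map_mul := by
    have h0 : map f h n zero = zero := congrArg low (Subtype.ext hf.map_one)
    rintro (x | i | x) (y | j | y) <;> try first | rfl | exact h0
    · exact congrArg up (hf.map_mul x y)
    · exact congrArg low (Subtype.ext (hf.map_imp x y.1))
    · change map f h n (mul (mid i) (mid j)) = mul (mid i) (mid j)
      simp only [mul]
      split_ifs
      · rfl
      · exact h0
    · exact congrArg low (Subtype.ext (hf.map_imp y x.1))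
  map_imp := by
    have h1 : map f h n (up 1) = up 1 := congrArg up hf.map_one
    rintro (x | i | x) (y | j | y) <;> try first | rfl | exact h1
    · exact congrArg up (hf.map_imp x y)
    · exact congrArg low (Subtype.ext ((h _).trans (congrArg ε (hf.map_mul x y.1))))
    · change map f h n (imp (mid i) (mid j)) = imp (mid i) (mid j)
      simp only [imp]
      split_ifs
      · exact h1
      · rfl
    · exact congrArg up (hf.map_imp y.1 x.1)
  map_one := congrArg up hf.map_one
  map_bot := congrArg low (Subtype.ext hf.map_one)
  injective := by
    rintro (x | i | x) (y | j | y) hxy <;> simp only [map, reduceCtorEq, up.injEq, low.injEq,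
      mid.injEq, Subtype.mk.injEq] at hxy
    · rw [hinj hxy]
    · rw [hxy]
    · rw [Subtype.ext (hinj hxy)]

/-- The inclusion of the `2`-rotation into the `n`-rotation. -/
def ofTwo (δ : RLNucleus A) (n : ℕ) : GenRotation δ 2 → GenRotation δ n
  | up a => up a
  | mid i => i.elim0
  | low b => low b

theorem isEmbedding_ofTwo : IsEmbedding (ofTwo δ n) where
  map_inf := by rintro (x | i | x) (y | j | y) <;> first | rfl | exact i.elim0 | exact j.elim0
  map_sup := by rintro (x | i | x) (y | j | y) <;> first | rfl | exact i.elim0 | exact j.elim0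
  map_mul := by rintro (x | i | x) (y | j | y) <;> first | rfl | exact i.elim0 | exact j.elim0
  map_imp := by rintro (x | i | x) (y | j | y) <;> first | rfl | exact i.elim0 | exact j.elim0
  map_one := rfl
  map_bot := rfl
  injective := by
    rintro (x | i | x) (y | j | y) h <;>
      first | exact i.elim0 | exact j.elim0 | (cases h <;> rfl)

theorem pow_two_eq_pow_three (hA : ∀ x : A, x ^ 2 = x ^ 3) (x : GenRotation δ 2) :
    x ^ 2 = x ^ 3 := by
  have h2 : ∀ y : GenRotation δ 2, y ^ 2 = y * y := fun y => pow_two y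
  have h3 : ∀ y : GenRotation δ 2, y ^ 3 = y * y * y := fun y => by rw [pow_succ, pow_two]
  rw [h2, h3]
  rcases x with x | i | x
  · have := hA x
    rw [pow_succ x 2, pow_two] at this
    exact congrArg up this
  · exact i.elim0
  · rfl

theorem neg_neg_identity (x : GenRotation (RLNucleus.identity A) 2) :
    CIRL.imp (CIRL.imp x ⊥) ⊥ = x := by
  rcases x with x | i | x
  · exact congrArg up ((CIRL.one_imp _).trans (mul_one x))
  · exact i.elim0
  · exact congrArg low (Subtype.ext ((mul_one _).trans (CIRL.one_imp x.1)))

theorem inf_neg_constOne (x : GenRotation (RLNucleus.constOne A) 2) :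
    x ⊓ CIRL.imp x ⊥ = ⊥ := by
  rcases x with x | i | x
  · rfl
  · exact i.elim0
  · -- the only fixed point of the nucleus is `1`
    exact congrArg low (Subtype.ext x.2.symm)

end GenRotation

/-! ### Varieties -/

theorem isVariety_MTL : IsVariety MTL.{u} where
  image A B f hf hs hA := by
    intro x y
    obtain ⟨x, rfl⟩ := hs x
    obtain ⟨y, rfl⟩ := hs y
    rw [← hf.map_imp, ← hf.map_imp, ← hf.map_sup, hA x y, hf.map_one]
  subalgebra A B f hf hB x y := hf.injective (by
    rw [hf.map_sup, hf.map_imp, hf.map_imp, hB, hf.map_one])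
  prod ι A hA x y := funext fun i => hA i (x i) (y i)

theorem genRotations_subset_MTL (n : ℕ) : genRotations.{u} n ⊆ MTL := by
  rintro _ ⟨A, _, δ, hA, rfl⟩
  exact GenRotation.prelinear hA

theorem generatedVariety_subset {K V : Set FLewAlg.{u}} (hV : IsVariety V) (h : K ⊆ V) :
    generatedVariety K ⊆ V := fun _ hD => hD V hV h

theorem generatedVariety_mono {K L : Set FLewAlg.{u}} (h : K ⊆ L) :
    generatedVariety K ⊆ generatedVariety L := fun _ hD V hV hL => hD V hV (h.trans hL)

theorem rotation_two_mem {A : Type u} [CIRL A] (hA : CIRL.Prelinear A) (δ : RLNucleus A) (n : ℕ) :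
    FLewAlg.mk (GenRotation δ 2) ∈ generatedVariety (genRotations.{u} n) := fun _ hV hK =>
  hV.subalgebra _ (FLewAlg.mk (GenRotation δ n)) (GenRotation.ofTwo δ n)
    GenRotation.isEmbedding_ofTwo (hK ⟨A, _, δ, hA, rfl⟩)

theorem mem_potent {m : ℕ} (hm : 2 ≤ m) {K : Set FLewAlg.{u}} {A : FLewAlg.{u}} (hA : A ∈ K)
    (h : ∀ x : A, x ^ 2 = x ^ 3) : A ∈ potent m K := by
  refine ⟨hA, fun x => ?_⟩
  obtain ⟨k, rfl⟩ := Nat.exists_eq_add_of_le hm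
  rw [add_right_comm, pow_add, pow_add, h x]

/-! ### Failure of amalgamation -/

/-- A class of semilinear algebras that contains the `2`-rotations of the three chains, with respect
to compatible nuclei, fails the amalgamation property. -/
theorem not_hasAP_of_rotation_mem {K : Set FLewAlg.{u}} (hK : K ⊆ MTL)
    {δA : RLNucleus ChainA.{u}} {δB : RLNucleus ChainB.{u}} {δC : RLNucleus ChainC.{u}}
    (hB : ∀ x, ChainA.toB (δA x) = δB (ChainA.toB x))
    (hC : ∀ x, ChainA.toC (δA x) = δC (ChainA.toC x))
    (memA : FLewAlg.mk (GenRotation δA 2) ∈ K) (memB : FLewAlg.mk (GenRotation δB 2) ∈ K)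
    (memC : FLewAlg.mk (GenRotation δC 2) ∈ K) : ¬ HasAP K := by
  intro hAP
  obtain ⟨D, hD, h, k, hh, hk, hcomp⟩ := hAP _ memA _ memB _ memC
    (GenRotation.map _ hB 2) (GenRotation.map _ hC 2)
    (GenRotation.isEmbedding_map hB ChainA.isRLHom_toB ChainA.toB_injective)
    (GenRotation.isEmbedding_map hC ChainA.isRLHom_toC ChainA.toC_injective)
  have ha : h (.up .a) = k (.up .a) := congrFun hcomp (.up .a)
  have hb : h (.up .b) = 1 := CIRL.eq_one_of_amalgam (hK hD)
    (a := h (.up .a)) (c := k (.up .c)) (d := k (.up .d)) (z := k (.up .z))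
    (hh.map_mul (.up .b) (.up .b)).symm (hh.map_imp (.up .b) (.up .a)).symm
    (by rw [ha]; exact (hk.map_mul (.up .a) (.up .d)).symm)
    (by rw [ha]; exact (hk.map_imp (.up .d) (.up .c)).symm)
    (by rw [ha]; exact (hk.map_imp (.up .c) (.up .z)).symm)
  have := hh.injective (hb.trans hh.map_one.symm)
  cases this

theorem ChainA.prelinear : CIRL.Prelinear ChainA.{u} := CIRL.prelinear_of_total le_total

theorem ChainB.prelinear : CIRL.Prelinear ChainB.{u} := CIRL.prelinear_of_total le_total

theorem ChainC.prelinear : CIRL.Prelinear ChainC.{u} := CIRL.prelinear_of_total le_total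

/-- Membership in `K` is only needed for the rotations of semilinear residuated lattices with respect
to a uniformly chosen nucleus; the conclusion then also covers the `m`-potent members of `K`. -/
theorem not_hasAP_and_potent {K : Set FLewAlg.{u}} (hK : K ⊆ MTL)
    (δ : ∀ (A : Type u) [CIRL A], RLNucleus A)
    (hB : ∀ x, ChainA.toB.{u} (δ _ x) = δ _ (ChainA.toB x))
    (hC : ∀ x, ChainA.toC.{u} (δ _ x) = δ _ (ChainA.toC x))
    (mem : ∀ (A : Type u) [CIRL A], CIRL.Prelinear A → FLewAlg.mk (GenRotation (δ A) 2) ∈ K) :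
    ¬ HasAP K ∧ ∀ m, 2 ≤ m → ¬ HasAP (potent m K) := by
  have memA := mem _ ChainA.prelinear
  have memB := mem _ ChainB.prelinear
  have memC := mem _ ChainC.prelinear
  refine ⟨not_hasAP_of_rotation_mem hK hB hC memA memB memC, fun m hm =>
    not_hasAP_of_rotation_mem (fun _ h => hK h.1) hB hC
      (mem_potent hm memA (GenRotation.pow_two_eq_pow_three ?_))
      (mem_potent hm memB (GenRotation.pow_two_eq_pow_three ?_))
      (mem_potent hm memC (GenRotation.pow_two_eq_pow_three ?_))⟩
  · rintro (_ | _) <;> rw [pow_succ _ 2, pow_two] <;> rfl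
  · rintro (_ | _ | _) <;> rw [pow_succ _ 2, pow_two] <;> rfl
  · rintro (_ | _ | _ | _ | _) <;> rw [pow_succ _ 2, pow_two] <;> rfl

theorem mainTheorem3 :
    (¬ HasAP IMTL.{u}) ∧
    (¬ HasAP SMTL.{u}) ∧
    (∀ n : ℕ, 2 ≤ n → ¬ HasAP (generatedVariety (genRotations.{u} n))) ∧
    (¬ HasAP (generatedVariety (⋃ n ≥ 2, genRotations.{u} n))) ∧
    (∀ m : ℕ, 2 ≤ m →
      (¬ HasAP (potent m IMTL.{u})) ∧
      (¬ HasAP (potent m SMTL.{u})) ∧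
      (∀ n : ℕ, 2 ≤ n → ¬ HasAP (potent m (generatedVariety (genRotations.{u} n)))) ∧
      (¬ HasAP (potent m (generatedVariety (⋃ n ≥ 2, genRotations.{u} n))))) := by
  have hI := not_hasAP_and_potent (K := IMTL.{u}) (fun _ h => h.1)
    (fun A _ => RLNucleus.identity A) (fun _ => rfl) (fun _ => rfl)
    fun A _ hA => ⟨GenRotation.prelinear hA, GenRotation.neg_neg_identity⟩
  have hS := not_hasAP_and_potent (K := SMTL.{u}) (fun _ h => h.1)
    (fun A _ => RLNucleus.constOne A) (fun _ => rfl) (fun _ => rfl)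
    fun A _ hA => ⟨GenRotation.prelinear hA, GenRotation.inf_neg_constOne⟩
  have hn (n : ℕ) := not_hasAP_and_potent
    (generatedVariety_subset isVariety_MTL (genRotations_subset_MTL.{u} n))
    (fun A _ => RLNucleus.identity A) (fun _ => rfl) (fun _ => rfl)
    fun A _ hA => rotation_two_mem hA _ n
  have hU := not_hasAP_and_potent
    (generatedVariety_subset isVariety_MTL
      (Set.iUnion₂_subset (s := fun n (_ : n ≥ 2) => genRotations.{u} n)
        fun n _ => genRotations_subset_MTL n))
    (fun A _ => RLNucleus.identity A) (fun _ => rfl) (fun _ => rfl)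
    fun A _ hA => generatedVariety_mono
      (Set.subset_iUnion₂ (s := fun n (_ : n ≥ 2) => genRotations.{u} n) 2 le_rfl)
      (rotation_two_mem hA _ 2)
  exact ⟨hI.1, hS.1, fun n _ => (hn n).1, hU.1, fun m hm =>
    ⟨hI.2 m hm, hS.2 m hm, fun n _ => (hn n).2 m hm, hU.2 m hm⟩⟩
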